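/- Let $X$ be a compact metrizable space, let $\theta\colon X\to X$ be a Borel measurable map preserving a Borel probability measure $\mu$ on $X$ (for instance a continuous map preserving $\mu$), and let $(t_\ell)_{\ell\ge1}$ be a sequence of integers with $t_1\ge1$ and $t_{\ell+1}=2t_\ell$ for all $\ell\ge1$. For each integer $n\ge1$ let $\varphi(n,\cdot)\colon X\to\mathbb{R}\cup\{-\infty\}$ be a measurable function such that for all $k_1,k_2\ge1$ $$\varphi(k_1+k_2,x)\le\varphi(k_1,x)+\varphi(k_2,\theta^{k_1}(x))\qquad\text{for }\mu\text{-a.e. }x\in X,$$ and suppose that (a) $\varphi(n,\cdot)\in L^1(X,\mu)$ for all $n\ge1$, and (b) there is a $\mu$-integrable function $g\colon X\to\mathbb{R}$ such that $g\le\frac1n\varphi(n,\cdot)$ $\mu$-a.e. for every $n\ge1$. Then there exist a measurable $\mu$-integrable function $\bar\varphi\colon X\to\mathbb{R}$ with $$\int_X\bar\varphi\,d\mu=\lim_{n\to\infty}\frac1n\int_X\varphi(n,x)\,\mu(dx)=\inf_{n\ge1}\frac1n\int_X\varphi(n,x)\,\mu(dx)$$ and a Borel set $\widehat\Gamma\subset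 X$ with $\mu(\widehat\Gamma)=1$ such that for every $x\in\widehat\Gamma$ $$\bar\varphi(x)=\lim_{n\to\infty}\frac1n\varphi(n,x),\qquad \bar\varphi(\theta^n(x))=\bar\varphi(x)\quad\text{for all }n>0,$$ and, for every $\ell\ge1$, the inner limit below exists and is finite, and $$\lim_{\ell\to\infty}\left\{\lim_{k\to\infty}\frac1k\sum_{j=0}^{k-1}\frac1{t_\ell}\varphi\bigl(t_\ell,\theta^{jt_\ell}(x)\bigr)\right\}=\bar\varphi(x).$$ -/

import Mathlib

open MeasureTheory Filter Topology

/-! By (b), `φ n` agrees a.e. with a real cocycle `f n`. Put `L = liminf f n / n`. Cutting an orbit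
into blocks of length `t` and applying Birkhoff's theorem to `T^[t]` gives `limsup f n / n ≤
blockAverage t` a.e. for every `t ≥ 1` (`ae_eventually_div_lt_of_blockAverage_lt`). Doubling `t` can
only lower the block average (`ae_blockAverage_two_mul_le`), so along `t l` the block averages
decrease and stay above `L`, while their integrals tend to the Fekete limit `γ` of `(∫ f n) / n`.

The converse bound `γ ≤ ∫ L` (`le_integral_of_frequently_lt`) is a covering argument: almost every
orbit splits into blocks on which `f` is nearly as small as `L` predicts. Hence `∫ L = γ`, and a
decreasing sequence above `L` whose integrals tend to `∫ L` converges to `L` a.e. This is the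
iterated limit, and it also forces `limsup f n / n ≤ L`, hence pointwise convergence. -/

/-! ### Maximal inequality and Birkhoff's theorem. -/

section MaximalErgodic

variable {α : Type*}

/-- The running maximum `max_{0 ≤ k ≤ n} S_k G` of the Birkhoff sums of `G`, by recursion. -/
noncomputable def birkhoffMax (T : α → α) (G : α → ℝ) : ℕ → α → ℝ
  | 0, _ => 0
  | n + 1, x => max 0 (G x + birkhoffMax T G n (T x))

theorem birkhoffMax_nonneg (T : α → α) (G : α → ℝ) (n : ℕ) (x : α) :
    0 ≤ birkhoffMax T G n x := by
  cases n with
  | zero => exact le_rfl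
  | succ n => exact le_max_left _ _

theorem birkhoffMax_le_succ (T : α → α) (G : α → ℝ) (n : ℕ) (x : α) :
    birkhoffMax T G n x ≤ birkhoffMax T G (n + 1) x := by
  induction n generalizing x with
  | zero => exact le_max_left _ _
  | succ n ih => exact max_le_max le_rfl (by linarith [ih (T x)])

theorem birkhoffMax_monotone (T : α → α) (G : α → ℝ) (x : α) :
    Monotone (fun n => birkhoffMax T G n x) :=
  monotone_nat_of_le_succ fun n => birkhoffMax_le_succ T G n x

theorem birkhoffSum_le_birkhoffMax (T : α → α) (G : α → ℝ) (n : ℕ) (x : α) :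
    birkhoffSum T G n x ≤ birkhoffMax T G n x := by
  induction n generalizing x with
  | zero => simp [birkhoffMax]
  | succ n ih =>
    rw [birkhoffSum_succ']
    exact le_max_of_le_right (by linarith [ih (T x)])

/-- The left side has nonnegative integral by monotonicity in `n` and invariance of the measure; the
right side is eventually `G x` wherever the maxima along `T x` tend to infinity. -/
theorem birkhoffMax_succ_sub (T : α → α) (G : α → ℝ) (n : ℕ) (x : α) :
    birkhoffMax T G (n + 1) x - birkhoffMax T G n (T x) =
      max (-birkhoffMax T G n (T x)) (G x) := by
  rw [birkhoffMax, ← max_sub_sub_right]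
  simp

/-- Makes the unboundedness set strictly invariant, so that the measure can be restricted to it and
it lies in the invariant σ-algebra. -/
theorem bddAbove_birkhoffMax_comp_iff (T : α → α) (G : α → ℝ) (x : α) :
    BddAbove (Set.range fun n => birkhoffMax T G n (T x)) ↔
      BddAbove (Set.range fun n => birkhoffMax T G n x) := by
  constructor
  · rintro ⟨C, hC⟩
    refine ⟨max 0 (G x + C), ?_⟩
    rintro _ ⟨n, rfl⟩
    have : birkhoffMax T G n (T x) ≤ C := hC ⟨n, rfl⟩
    exact (birkhoffMax_le_succ T G n x).trans (max_le_max le_rfl (by linarith))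
  · rintro ⟨C, hC⟩
    refine ⟨C - G x, ?_⟩
    rintro _ ⟨n, rfl⟩
    have h1 : birkhoffMax T G (n + 1) x ≤ C := hC ⟨n + 1, rfl⟩
    have h2 : G x + birkhoffMax T G n (T x) ≤ birkhoffMax T G (n + 1) x := le_max_right _ _
    simp only
    linarith

variable [MeasurableSpace α] {μ : Measure α} {T : α → α} {G : α → ℝ}

theorem measurable_birkhoffMax (hT : Measurable T) (hG : Measurable G) (n : ℕ) :
    Measurable (birkhoffMax T G n) := by
  induction n with
  | zero => exact measurable_const
  | succ n ih => exact measurable_const.max (hG.add (ih.comp hT))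

theorem integrable_birkhoffMax [IsFiniteMeasure μ] (hT : MeasurePreserving T μ μ)
    (hG : Integrable G μ) (n : ℕ) : Integrable (birkhoffMax T G n) μ := by
  induction n with
  | zero => exact integrable_zero _ _ _
  | succ n ih =>
    exact (integrable_zero _ _ _).sup (hG.add (hT.integrable_comp_of_integrable ih))

/-- The maximal ergodic inequality on the set where the Birkhoff sums are unbounded above. -/
theorem setIntegral_nonneg_of_not_bddAbove_birkhoffMax [IsFiniteMeasure μ]
    (hT : MeasurePreserving T μ μ) (hGm : Measurable G) (hG : Integrable G μ) :
    0 ≤ ∫ x in {x | ¬ BddAbove (Set.range fun n => birkhoffMax T G n x)}, G x ∂μ := by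
  set A := {x | ¬ BddAbove (Set.range fun n => birkhoffMax T G n x)} with hA
  have hAm : MeasurableSet A :=
    (measurableSet_bddAbove_range (measurable_birkhoffMax hT.measurable hGm)).compl
  have hTA : T ⁻¹' A = A := by
    ext x
    simp only [hA, Set.mem_preimage, Set.mem_ofPred_eq, bddAbove_birkhoffMax_comp_iff]
  have hTr : MeasurePreserving T (μ.restrict A) (μ.restrict A) := by
    simpa [hTA] using hT.restrict_preimage hAm
  have hint := fun n => integrable_birkhoffMax hTr (hG.restrict (s := A)) n
  have hlim : Tendsto (fun n => ∫ x in A, max (-birkhoffMax T G n (T x)) (G x) ∂μ) atTop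
      (𝓝 (∫ x in A, G x ∂μ)) := by
    refine tendsto_integral_of_dominated_convergence (fun x => |G x|) (fun n => ?_) hG.restrict.abs
      (fun n => ae_of_all _ fun x => ?_) ((ae_restrict_iff' hAm).2 (ae_of_all _ fun x hx => ?_))
    · exact (((measurable_birkhoffMax hT.measurable hGm n).comp hT.measurable).neg.max
        hGm).aestronglyMeasurable
    · rw [Real.norm_eq_abs, abs_le]
      exact ⟨(neg_abs_le _).trans (le_max_right _ _), max_le
        (by linarith [birkhoffMax_nonneg T G n (T x), abs_nonneg (G x)]) (le_abs_self _)⟩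
    · have hx' : T x ∈ A := by rw [← Set.mem_preimage, hTA]; exact hx
      have hinf : Tendsto (fun n => birkhoffMax T G n (T x)) atTop atTop :=
        tendsto_atTop_atTop_of_monotone (birkhoffMax_monotone T G (T x)) fun b => by
          obtain ⟨_, ⟨n, rfl⟩, hn⟩ := not_bddAbove_iff.1 hx' b
          exact ⟨n, hn.le⟩
      refine tendsto_const_nhds.congr' ?_
      filter_upwards [hinf.eventually_ge_atTop (-G x)] with n hn
      rw [max_eq_right (by linarith)]
  refine ge_of_tendsto' hlim fun n => ?_
  simp_rw [← birkhoffMax_succ_sub]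
  rw [integral_sub (g := fun x => birkhoffMax T G n (T x)) (hint (n + 1))
    (hTr.integrable_comp_of_integrable (hint n))]
  have : ∫ x in A, birkhoffMax T G n (T x) ∂μ = ∫ x in A, birkhoffMax T G n x ∂μ := by
    conv_rhs => rw [← hTr.map_eq]
    rw [integral_map hT.measurable.aemeasurable]
    exact (measurable_birkhoffMax hT.measurable hGm n).aestronglyMeasurable
  rw [this, sub_nonneg]
  exact integral_mono (hint n) (hint (n + 1)) fun x => birkhoffMax_le_succ T G n x

/-- For `G = f - (h + ε)` the integral over the invariant unboundedness set `A` is `-ε μ(A)`; the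
maximal inequality makes it nonnegative, so `A` is null. -/
theorem ae_bddAbove_birkhoffSum_sub_condExp [IsFiniteMeasure μ] (hT : MeasurePreserving T μ μ)
    {f : α → ℝ} (hfm : Measurable f) (hf : Integrable f μ) {ε : ℝ} (hε : 0 < ε) :
    ∀ᵐ x ∂μ, ∃ C, ∀ n : ℕ, birkhoffSum T f n x ≤
      n * ((μ[f | MeasurableSpace.invariants T]) x + ε) + C := by
  have hI := MeasurableSpace.invariants_le T
  set h := μ[f | MeasurableSpace.invariants T] with hh
  have hhI : Measurable[MeasurableSpace.invariants T] h := stronglyMeasurable_condExp.measurable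
  have hhm : Measurable h := hhI.mono hI le_rfl
  have hinv : h ∘ T = h := MeasurableSpace.comp_eq_of_measurable_invariants hhI
  have hhi : Integrable h μ := integrable_condExp
  set G : α → ℝ := fun x => f x - (h x + ε) with hGdef
  have hGm : Measurable G := hfm.sub (hhm.add_const ε)
  have hhε : Integrable (fun x => h x + ε) μ := hhi.add (integrable_const ε)
  have hG : Integrable G μ := hf.sub hhε
  have key := setIntegral_nonneg_of_not_bddAbove_birkhoffMax hT hGm hG
  set A := {x | ¬ BddAbove (Set.range fun n => birkhoffMax T G n x)} with hA
  have hAm : MeasurableSet[MeasurableSpace.invariants T] A := by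
    refine MeasurableSpace.measurableSet_invariants.2
      ⟨(measurableSet_bddAbove_range (measurable_birkhoffMax hT.measurable hGm)).compl, ?_⟩
    ext x
    simp only [hA, Set.mem_preimage, Set.mem_ofPred_eq, bddAbove_birkhoffMax_comp_iff]
  have hzero : μ A = 0 := by
    rw [hGdef, integral_sub hf.integrableOn hhε.integrableOn,
      integral_add hhi.integrableOn (integrable_const ε),
      setIntegral_condExp hI hf hAm, setIntegral_const, smul_eq_mul] at key
    have h0 : μ.real A = 0 := by
      have := measureReal_nonneg (μ := μ) (s := A)
      nlinarith
    exact (measureReal_eq_zero_iff).1 h0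
  have hae : ∀ᵐ x ∂μ, x ∉ A := measure_eq_zero_iff_ae_notMem.1 hzero
  filter_upwards [hae] with x hx
  obtain ⟨C, hC⟩ := not_not.1 hx
  refine ⟨C, fun n => ?_⟩
  have h1 : birkhoffSum T G n x ≤ C := (birkhoffSum_le_birkhoffMax T G n x).trans (hC ⟨n, rfl⟩)
  have hinv' : (fun x => h x + ε) ∘ T = fun x => h x + ε := by
    funext y
    simp only [Function.comp_apply, add_left_inj]
    exact congrFun hinv y
  have h2 : birkhoffSum T G n x = birkhoffSum T f n x - n * (h x + ε) := by
    have := birkhoffSum_sub T f (fun x => h x + ε) n x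
    rw [birkhoffSum_of_comp_eq hinv', Pi.smul_apply, nsmul_eq_mul] at this
    exact this
  linarith

theorem ae_eventually_birkhoffSum_div_le [IsFiniteMeasure μ] (hT : MeasurePreserving T μ μ)
    {f : α → ℝ} (hfm : Measurable f) (hf : Integrable f μ) :
    ∀ᵐ x ∂μ, ∀ a, (μ[f | MeasurableSpace.invariants T]) x < a →
      ∀ᶠ n : ℕ in atTop, birkhoffSum T f n x / n < a := by
  have hae : ∀ᵐ x ∂μ, ∀ m : ℕ, ∃ C, ∀ n : ℕ, birkhoffSum T f n x ≤
      n * ((μ[f | MeasurableSpace.invariants T]) x + 1 / ((m : ℝ) + 1)) + C :=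
    ae_all_iff.2 fun m => ae_bddAbove_birkhoffSum_sub_condExp hT hfm hf Nat.one_div_pos_of_nat
  filter_upwards [hae] with x hx a ha
  obtain ⟨m, hm⟩ := exists_nat_one_div_lt (sub_pos.2 ha)
  obtain ⟨C, hC⟩ := hx m
  have hlim : Tendsto (fun n : ℕ => (μ[f | MeasurableSpace.invariants T]) x + 1 / ((m : ℝ) + 1)
      + C / n) atTop (𝓝 ((μ[f | MeasurableSpace.invariants T]) x + 1 / ((m : ℝ) + 1) + 0)) :=
    tendsto_const_nhds.add (tendsto_const_div_atTop_nhds_zero_nat C)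
  filter_upwards [hlim.eventually_lt_const (show _ < a by linarith), eventually_gt_atTop 0]
    with n hn hpos
  have hpos' : (0 : ℝ) < n := Nat.cast_pos.2 hpos
  refine lt_of_le_of_lt ?_ hn
  rw [div_le_iff₀ hpos', add_mul, div_mul_cancel₀ _ hpos'.ne']
  linarith [hC n]

/-- **Birkhoff's pointwise ergodic theorem**: Birkhoff averages converge almost everywhere to the
conditional expectation with respect to the invariant σ-algebra. -/
theorem ae_tendsto_birkhoffSum_div [IsFiniteMeasure μ] (hT : MeasurePreserving T μ μ)
    {f : α → ℝ} (hfm : Measurable f) (hf : Integrable f μ) :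
    ∀ᵐ x ∂μ, Tendsto (fun n : ℕ => birkhoffSum T f n x / n) atTop
      (𝓝 ((μ[f | MeasurableSpace.invariants T]) x)) := by
  filter_upwards [ae_eventually_birkhoffSum_div_le hT hfm hf,
    ae_eventually_birkhoffSum_div_le hT hfm.neg hf.neg,
    condExp_neg (μ := μ) f (MeasurableSpace.invariants T)] with x h1 h2 h3
  refine tendsto_order.2 ⟨fun a ha => ?_, h1⟩
  filter_upwards [h2 (-a) (by rw [h3]; simpa using ha)] with n hn
  have : birkhoffSum T (-f) n x = - birkhoffSum T f n x := birkhoffSum_neg T f n x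
  rw [this, neg_div] at hn
  linarith

/-- The term is a difference of consecutive Birkhoff sums, whose averages share a finite limit. -/
theorem ae_tendsto_comp_iterate_div [IsFiniteMeasure μ] (hT : MeasurePreserving T μ μ)
    {f : α → ℝ} (hfm : Measurable f) (hf : Integrable f μ) :
    ∀ᵐ x ∂μ, Tendsto (fun n : ℕ => f (T^[n] x) / n) atTop (𝓝 0) := by
  filter_upwards [ae_tendsto_birkhoffSum_div hT hfm hf] with x hx
  set c := (μ[f | MeasurableSpace.invariants T]) x
  have h1 : Tendsto (fun n : ℕ => birkhoffSum T f (n + 1) x / ((n + 1 : ℕ) : ℝ)) atTop (𝓝 c) :=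
    hx.comp (tendsto_add_atTop_nat 1)
  have h2 : Tendsto (fun n : ℕ => (((n + 1 : ℕ) : ℝ) / n)) atTop (𝓝 1) := by
    have : Tendsto (fun n : ℕ => 1 + 1 / (n : ℝ)) atTop (𝓝 (1 + 0)) :=
      tendsto_const_nhds.add (tendsto_const_div_atTop_nhds_zero_nat 1)
    rw [add_zero] at this
    refine this.congr' ?_
    filter_upwards [eventually_gt_atTop 0] with n hn
    have : (n : ℝ) ≠ 0 := by positivity
    push_cast
    field_simp
  have h3 := (h1.mul h2).sub hx
  rw [mul_one, sub_self] at h3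
  refine h3.congr' ?_
  filter_upwards [eventually_gt_atTop 0] with n hn
  have : (n : ℝ) ≠ 0 := by positivity
  have h4 : ((n + 1 : ℕ) : ℝ) ≠ 0 := by positivity
  rw [birkhoffSum_succ]
  field_simp
  ring

end MaximalErgodic

/-! ### Covering argument and the lower bound for `∫ L`. -/

section Kingman

variable {α : Type*}

/-- Provides the forward invariant sets of full measure on which a.e. subadditivity can be iterated
pointwise. -/
theorem mapsTo_forall_iterate (T : α → α) (p : α → Prop) :
    Set.MapsTo T {x | ∀ i : ℕ, p (T^[i] x)} {x | ∀ i : ℕ, p (T^[i] x)} := fun _ hx i => hx (i + 1)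

theorem le_birkhoffSum_of_subadditive {T : α → α} {f : ℕ → α → ℝ} {s : Set α}
    (hs : Set.MapsTo T s s) (h0 : ∀ x, f 0 x = 0)
    (hsub : ∀ x ∈ s, ∀ m n, f (m + n) x ≤ f m x + f n (T^[m] x)) (t k : ℕ) {x : α} (hx : x ∈ s) :
    f (k * t) x ≤ birkhoffSum (T^[t]) (f t) k x := by
  induction k generalizing x with
  | zero => simp [h0]
  | succ k ih =>
    rw [birkhoffSum_succ', show (k + 1) * t = t + k * t by ring]
    exact (hsub x hx t (k * t)).trans (add_le_add le_rfl (ih (hs.iterate t hx)))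

/-- If from every point some subadditive block of length at most `N` is dominated by the Birkhoff
sum of `ψ`, then so is every `f n`, up to an error supported on the last `N` steps of the orbit. -/
theorem le_birkhoffSum_add_sum_Ico {T : α → α} {f : ℕ → α → ℝ} {ψ w : α → ℝ} {s : Set α} {N : ℕ}
    (hs : Set.MapsTo T s s) (h0 : ∀ x, f 0 x = 0)
    (hsub : ∀ x ∈ s, ∀ m n, f (m + n) x ≤ f m x + f n (T^[m] x))
    (hw : ∀ x, 0 ≤ w x) (hfw : ∀ x, f 1 x ≤ ψ x + w x)
    (hcov : ∀ x ∈ s, ∃ l, 1 ≤ l ∧ l ≤ N ∧ f l x ≤ birkhoffSum T ψ l x)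
    (n : ℕ) {x : α} (hx : x ∈ s) :
    f n x ≤ birkhoffSum T ψ n x + ∑ i ∈ Finset.Ico (n - N) n, w (T^[i] x) := by
  induction n using Nat.strong_induction_on generalizing x with
  | _ n ih =>
    obtain ⟨l, hl1, hlN, hl⟩ := hcov x hx
    rcases le_or_gt l n with hln | hln
    · obtain ⟨m, rfl⟩ := Nat.exists_eq_add_of_le hln
      have h1 := ih m (by omega) (hs.iterate l hx)
      have h2 : ∑ i ∈ Finset.Ico (m - N) m, w (T^[i] (T^[l] x)) ≤
          ∑ i ∈ Finset.Ico (l + m - N) (l + m), w (T^[i] x) := by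
        simp_rw [← Function.iterate_add_apply]
        rw [Finset.sum_Ico_add' (fun i => w (T^[i] x))]
        refine Finset.sum_le_sum_of_subset_of_nonneg ?_ fun i _ _ => hw _
        exact Finset.Ico_subset_Ico (by omega) (by omega)
      rw [birkhoffSum_add]
      linarith [hsub x hx l m]
    -- No block fits: `n < l ≤ N`, so the error window is all of `range n` and single steps suffice.
    · have h1 := le_birkhoffSum_of_subadditive hs h0 hsub 1 n hx
      rw [mul_one, Function.iterate_one] at h1
      rw [show n - N = 0 by omega, ← Finset.range_eq_Ico]
      refine h1.trans ?_
      simp only [birkhoffSum, ← Finset.sum_add_distrib]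
      exact Finset.sum_le_sum fun i _ => hfw _

variable [MeasurableSpace α] {μ : Measure α} {T : α → α} {f : ℕ → α → ℝ}

theorem MeasureTheory.MeasurePreserving.integral_comp_self (hT : MeasurePreserving T μ μ)
    {g : α → ℝ} (hg : AEStronglyMeasurable g μ) : ∫ x, g (T x) ∂μ = ∫ x, g x ∂μ := by
  conv_rhs => rw [← hT.map_eq]
  rw [integral_map hT.measurable.aemeasurable (by rwa [hT.map_eq])]

theorem MeasureTheory.MeasurePreserving.ae_forall_iterate (hT : MeasurePreserving T μ μ)
    {p : α → Prop} (hp : ∀ᵐ x ∂μ, p x) : ∀ᵐ x ∂μ, ∀ i : ℕ, p (T^[i] x) :=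
  ae_all_iff.2 fun i => (hT.iterate i).quasiMeasurePreserving.ae hp

theorem integrable_birkhoffSum (hT : MeasurePreserving T μ μ) {g : α → ℝ} (hg : Integrable g μ)
    (n : ℕ) : Integrable (birkhoffSum T g n) μ :=
  integrable_finsetSum _ fun i _ => (hT.iterate i).integrable_comp_of_integrable hg

theorem integral_birkhoffSum (hT : MeasurePreserving T μ μ) {g : α → ℝ} (hg : Integrable g μ)
    (n : ℕ) : ∫ x, birkhoffSum T g n x ∂μ = n * ∫ x, g x ∂μ := by
  simp only [birkhoffSum]
  rw [integral_finsetSum (f := fun i x => g (T^[i] x)) _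
    fun i _ => (hT.iterate i).integrable_comp_of_integrable hg]
  simp [(hT.iterate _).integral_comp_self hg.aestronglyMeasurable]

theorem ae_subadditive_orbit (hT : MeasurePreserving T μ μ)
    (hsub : ∀ m n, ∀ᵐ x ∂μ, f (m + n) x ≤ f m x + f n (T^[m] x)) :
    ∀ᵐ x ∂μ, ∀ i m n : ℕ, f (m + n) (T^[i] x) ≤ f m (T^[i] x) + f n (T^[m] (T^[i] x)) :=
  hT.ae_forall_iterate (ae_all_iff.2 fun m => ae_all_iff.2 fun n => hsub m n)

/-- The lower bound in Kingman's theorem: if the invariant function `L` is at least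
`liminf f n / n`, then its integral is at least any `γ` with `n γ ≤ ∫ f n`. -/
theorem le_integral_of_frequently_lt [IsProbabilityMeasure μ] (hT : MeasurePreserving T μ μ)
    (h0 : ∀ x, f 0 x = 0) (hfm : ∀ n, Measurable (f n)) (hfi : ∀ n, Integrable (f n) μ)
    (hsub : ∀ m n, ∀ᵐ x ∂μ, f (m + n) x ≤ f m x + f n (T^[m] x))
    {L : α → ℝ} (hLm : Measurable L) (hLi : Integrable L μ) (hLT : ∀ᵐ x ∂μ, L (T x) = L x)
    (hL : ∀ᵐ x ∂μ, ∀ a, L x < a → ∃ n : ℕ, 1 ≤ n ∧ f n x < n * a)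
    {γ : ℝ} (hγ : ∀ n : ℕ, n * γ ≤ ∫ x, f n x ∂μ) : γ ≤ ∫ x, L x ∂μ := by
  classical
  refine le_of_forall_pos_le_add fun ε hε => ?_
  -- Good points, which have a block of length at most `N` with average below `L + ε`.
  set B : ℕ → Set α := fun N => {x | ∃ l, 1 ≤ l ∧ l ≤ N ∧ f l x < l * (L x + ε)} with hB
  have hBm : ∀ N, MeasurableSet (B N) := by
    intro N
    simp only [hB, Set.ofPred_exists, Set.ofPred_and]
    exact MeasurableSet.iUnion fun l => (MeasurableSet.const _).inter ((MeasurableSet.const _).inter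
      (measurableSet_lt (hfm l) ((hLm.add_const ε).const_mul _)))
  -- Off `B N` a block of length one is used, so `ψ` must dominate `f 1` there. The bound `ψ ≥ L +
  -- ε` everywhere keeps good blocks valid even when they leave `B N`.
  set ψ : ℕ → α → ℝ := fun N => (B N).piecewise (fun x => L x + ε) (fun x => max (f 1 x) (L x + ε))
    with hψ
  have hψm : ∀ N, Measurable (ψ N) := fun N =>
    (hLm.add_const ε).piecewise (hBm N) ((hfm 1).max (hLm.add_const ε))
  have hψge : ∀ N x, L x + ε ≤ ψ N x := by
    intro N x
    by_cases hx : x ∈ B N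
    · simp [hψ, hx]
    · simp [hψ, hx]
  set b : α → ℝ := fun x => |f 1 x| + |L x| + ε with hb
  have hbi : Integrable b μ := ((hfi 1).abs.add hLi.abs).add (integrable_const ε)
  have hψb : ∀ N x, ‖ψ N x‖ ≤ b x := by
    intro N x
    rw [Real.norm_eq_abs, abs_le]
    constructor
    · have := hψge N x
      have h1 := neg_abs_le (L x)
      have h2 := abs_nonneg (f 1 x)
      simp only [hb]
      linarith
    · have h1 := le_abs_self (L x)
      have h2 := abs_nonneg (f 1 x)
      have h3 := abs_nonneg (L x)
      have h4 := le_abs_self (f 1 x)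
      by_cases hx : x ∈ B N
      · simp only [hψ, hx, Set.piecewise_eq_of_mem, hb]
        linarith
      · simp only [hψ, hx, not_false_eq_true, Set.piecewise_eq_of_notMem, hb]
        exact max_le (by linarith) (by linarith)
  have hψi : ∀ N, Integrable (ψ N) μ := fun N =>
    hbi.mono' (hψm N).aestronglyMeasurable (ae_of_all _ (hψb N))
  have hblock : ∀ N, 1 ≤ N → γ ≤ ∫ x, ψ N x ∂μ := by
    intro N hN
    set s : Set α := {x | ∀ i : ℕ, (∀ m n : ℕ, f (m + n) (T^[i] x) ≤
      f m (T^[i] x) + f n (T^[m] (T^[i] x))) ∧ ∀ j : ℕ, L (T^[j] (T^[i] x)) = L (T^[i] x)}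
      with hs_def
    have hs : Set.MapsTo T s s := mapsTo_forall_iterate T
      fun x => (∀ m n : ℕ, f (m + n) x ≤ f m x + f n (T^[m] x)) ∧ ∀ j : ℕ, L (T^[j] x) = L x
    have hs_ae : ∀ᵐ x ∂μ, x ∈ s := by
      have hinv : ∀ᵐ x ∂μ, ∀ j : ℕ, L (T^[j] x) = L x := by
        filter_upwards [hT.ae_forall_iterate hLT] with x hx j
        induction j with
        | zero => rfl
        | succ j ih => rw [Function.iterate_succ_apply', hx j, ih]
      filter_upwards [ae_subadditive_orbit hT hsub, hT.ae_forall_iterate hinv] with x h1 h2 i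
      exact ⟨h1 i, h2 i⟩
    have hcov : ∀ x ∈ s, ∃ l, 1 ≤ l ∧ l ≤ N ∧ f l x ≤ birkhoffSum T (ψ N) l x := by
      intro x hx
      by_cases hxB : x ∈ B N
      · obtain ⟨l, hl1, hlN, hl⟩ := id hxB
        refine ⟨l, hl1, hlN, hl.le.trans ?_⟩
        calc (l : ℝ) * (L x + ε) = ∑ i ∈ Finset.range l, (L x + ε) := by simp [mul_add]
          _ ≤ birkhoffSum T (ψ N) l x := Finset.sum_le_sum fun i _ => by
            have := hψge N (T^[i] x)
            rwa [show L (T^[i] x) = L x from (hx 0).2 i] at this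
      · refine ⟨1, le_rfl, hN, ?_⟩
        rw [birkhoffSum_one]
        simp [hψ, hxB]
    have hbound : ∀ n : ℕ, (n : ℝ) * γ ≤ n * ∫ x, ψ N x ∂μ + N * ∫ x, b x ∂μ := by
      intro n
      have hb0 : ∀ x, 0 ≤ b x := fun x => by positivity
      have hW : ∀ i, Integrable (fun x => b (T^[i] x)) μ := fun i =>
        (hT.iterate i).integrable_comp_of_integrable hbi
      calc (n : ℝ) * γ ≤ ∫ x, f n x ∂μ := hγ n
        _ ≤ ∫ x, (birkhoffSum T (ψ N) n x + ∑ i ∈ Finset.Ico (n - N) n, b (T^[i] x)) ∂μ := by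
          refine integral_mono_ae (hfi n) ((integrable_birkhoffSum hT (hψi N) n).add
            (integrable_finsetSum _ fun i _ => hW i)) ?_
          filter_upwards [hs_ae] with x hx
          refine le_birkhoffSum_add_sum_Ico hs h0 (fun x hx m n => (hx 0).1 m n) hb0 (fun x => ?_)
            hcov n hx
          have := hψge N x
          have h1 := neg_abs_le (L x)
          have h2 := le_abs_self (f 1 x)
          simp only [hb]
          linarith
        _ = n * ∫ x, ψ N x ∂μ + (n - (n - N) : ℕ) * ∫ x, b x ∂μ := by
          rw [integral_add (integrable_birkhoffSum hT (hψi N) n)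
            (integrable_finsetSum _ fun i _ => hW i), integral_birkhoffSum hT (hψi N),
            integral_finsetSum _ fun i _ => hW i]
          simp [(hT.iterate _).integral_comp_self hbi.aestronglyMeasurable]
        _ ≤ _ := by
          gcongr
          omega
    have hlim : Tendsto (fun n : ℕ => ∫ x, ψ N x ∂μ + (N * ∫ x, b x ∂μ) / n) atTop
        (𝓝 (∫ x, ψ N x ∂μ + 0)) :=
      tendsto_const_nhds.add (tendsto_const_div_atTop_nhds_zero_nat _)
    rw [add_zero] at hlim
    refine ge_of_tendsto hlim ?_
    filter_upwards [eventually_gt_atTop 0] with n hn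
    have hn' : (0 : ℝ) < n := Nat.cast_pos.2 hn
    have := hbound n
    refine le_of_mul_le_mul_left ?_ hn'
    rw [mul_add, mul_div_cancel₀ _ hn'.ne']
    exact this
  -- Almost every point lies in `B N` for all large `N`.
  have hlim : Tendsto (fun N => ∫ x, ψ N x ∂μ) atTop (𝓝 (∫ x, (L x + ε) ∂μ)) := by
    refine tendsto_integral_of_dominated_convergence b
      (fun N => (hψm N).aestronglyMeasurable) hbi (fun N => ae_of_all _ (hψb N)) ?_
    filter_upwards [hL] with x hx
    obtain ⟨l, hl1, hl⟩ := hx (L x + ε) (by linarith)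
    refine tendsto_const_nhds.congr' ?_
    filter_upwards [eventually_ge_atTop l] with N hN
    have : x ∈ B N := ⟨l, hl1, hN, hl⟩
    simp [hψ, this]
  rw [integral_add hLi (integrable_const ε)] at hlim
  simp only [integral_const, probReal_univ, smul_eq_mul, one_mul] at hlim
  exact ge_of_tendsto hlim (by filter_upwards [eventually_ge_atTop 1] with N hN using hblock N hN)

end Kingman

/-! ### Block averages and the upper bound. -/

section KingmanUpper

variable {α : Type*} [MeasurableSpace α] {μ : Measure α} {T : α → α} {f : ℕ → α → ℝ}

theorem tendsto_natCast_div_div_atTop {t : ℕ} (ht : 1 ≤ t) :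
    Tendsto (fun n : ℕ => ((n / t : ℕ) : ℝ) / n) atTop (𝓝 (1 / t)) := by
  have h := (tendsto_nat_floor_mul_div_atTop (R := ℝ) (a := 1 / t) (by positivity)).comp
    tendsto_natCast_atTop_atTop
  refine h.congr fun n => ?_
  rw [Function.comp_apply, one_div_mul_eq_div, Nat.floor_div_eq_div]

/-- The limit of the averages of `f t / t` along the orbits of `T^[t]`, as a conditional
expectation. -/
noncomputable def blockAverage (μ : Measure α) (T : α → α) (f : ℕ → α → ℝ) (t : ℕ) (x : α) : ℝ :=
  (μ[f t | MeasurableSpace.invariants (T^[t])]) x / t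

theorem integrable_blockAverage (t : ℕ) : Integrable (blockAverage μ T f t) μ :=
  integrable_condExp.div_const _

theorem integral_blockAverage [IsFiniteMeasure μ] (t : ℕ) :
    ∫ x, blockAverage μ T f t x ∂μ = (∫ x, f t x ∂μ) / t := by
  simp only [blockAverage]
  rw [integral_div, integral_condExp (MeasurableSpace.invariants_le _)]

/-- Write `n = k t + r` with `r < t`. The `k` full blocks are handled by Birkhoff's theorem for
`T^[t]`; the remainder is at most `R` at the `k`-th block endpoint, which is `o(k)`. -/
theorem ae_eventually_div_lt_of_blockAverage_lt [IsFiniteMeasure μ] (hT : MeasurePreserving T μ μ)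
    (h0 : ∀ x, f 0 x = 0) (hfm : ∀ n, Measurable (f n)) (hfi : ∀ n, Integrable (f n) μ)
    (hsub : ∀ m n, ∀ᵐ x ∂μ, f (m + n) x ≤ f m x + f n (T^[m] x)) {t : ℕ} (ht : 1 ≤ t) :
    ∀ᵐ x ∂μ, ∀ a, blockAverage μ T f t x < a → ∀ᶠ n : ℕ in atTop, f n x / n < a := by
  set R : α → ℝ := fun x => ∑ r ∈ Finset.range t, |f r x| with hR
  have hRm : Measurable R := Finset.measurable_sum _ fun r _ => (hfm r).abs
  have hRi : Integrable R μ := integrable_finsetSum _ fun r _ => (hfi r).abs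
  filter_upwards [ae_tendsto_birkhoffSum_div (hT.iterate t) (hfm t) (hfi t),
    ae_tendsto_comp_iterate_div (hT.iterate t) hRm hRi, ae_subadditive_orbit hT hsub]
    with x h1 h2 h3 a ha
  have hlim := ((h1.add h2).comp (Nat.tendsto_div_const_atTop (n := t) (by omega))).mul
    (tendsto_natCast_div_div_atTop ht)
  rw [add_zero, mul_one_div] at hlim
  filter_upwards [hlim.eventually_lt_const ha, eventually_ge_atTop t] with n hn hnt
  refine lt_of_le_of_lt ?_ hn
  have hk : (0 : ℝ) < ((n / t : ℕ) : ℝ) := Nat.cast_pos.2 (Nat.div_pos hnt ht)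
  have hn0 : (0 : ℝ) < n := Nat.cast_pos.2 (by omega)
  have hle : f n x ≤ birkhoffSum (T^[t]) (f t) (n / t) x + R ((T^[t])^[n / t] x) := by
    have h4 := le_birkhoffSum_of_subadditive
      (mapsTo_forall_iterate T fun x => ∀ m n : ℕ, f (m + n) x ≤ f m x + f n (T^[m] x)) h0
      (fun x hx m n => hx 0 m n) t (n / t) (x := x) h3
    have h5 := h3 0 (n / t * t) (n % t)
    rw [Nat.div_add_mod' n t] at h5
    have h6 : f (n % t) (T^[n / t * t] x) ≤ R ((T^[t])^[n / t] x) := by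
      rw [← Function.iterate_mul, mul_comm t]
      exact (le_abs_self _).trans (Finset.single_le_sum
        (f := fun r => |f r (T^[n / t * t] x)|) (fun _ _ => abs_nonneg _)
        (Finset.mem_range.2 (Nat.mod_lt n ht)))
    simp only [Function.iterate_zero, id_eq] at h5
    linarith
  simp only [Function.comp_apply]
  rw [← add_div, div_mul_div_cancel₀ hk.ne']
  gcongr

/-- The two conditional expectations are over different σ-algebras, so they are compared as limits
of Birkhoff averages: each block of length `2 t` splits into two of length `t`. -/
theorem ae_blockAverage_two_mul_le [IsFiniteMeasure μ] (hT : MeasurePreserving T μ μ)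
    (hfm : ∀ n, Measurable (f n)) (hfi : ∀ n, Integrable (f n) μ)
    (hsub : ∀ m n, ∀ᵐ x ∂μ, f (m + n) x ≤ f m x + f n (T^[m] x)) (t : ℕ) :
    ∀ᵐ x ∂μ, blockAverage μ T f (2 * t) x ≤ blockAverage μ T f t x := by
  filter_upwards [ae_tendsto_birkhoffSum_div (hT.iterate t) (hfm t) (hfi t),
    ae_tendsto_birkhoffSum_div (hT.iterate (2 * t)) (hfm (2 * t)) (hfi (2 * t)),
    ae_subadditive_orbit hT hsub] with x h1 h2 h3
  have h4 : Tendsto (fun k : ℕ => birkhoffSum (T^[t]) (f t) (2 * k) x / ((2 * k : ℕ) : ℝ)) atTop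
      (𝓝 ((μ[f t | MeasurableSpace.invariants (T^[t])]) x)) :=
    h1.comp (tendsto_id.const_mul_atTop' (by norm_num))
  have key : ∀ k : ℕ, birkhoffSum (T^[2 * t]) (f (2 * t)) k x ≤
      birkhoffSum (T^[t]) (f t) (2 * k) x := by
    intro k
    induction k with
    | zero => simp
    | succ k ih =>
      rw [mul_add, mul_one, birkhoffSum_succ, birkhoffSum_succ, birkhoffSum_succ]
      have h5 := h3 (2 * t * k) t t
      rw [← Function.iterate_add_apply, ← two_mul] at h5
      simp only [← Function.iterate_mul]
      rw [show t * (2 * k) = 2 * t * k by ring, show t * (2 * k + 1) = t + 2 * t * k by ring]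
      linarith
  have hle := le_of_tendsto_of_tendsto' h2 (h4.const_mul 2) fun k => by
    rcases Nat.eq_zero_or_pos k with rfl | hk
    · simp
    · have hk' : (0 : ℝ) < k := Nat.cast_pos.2 hk
      calc _ ≤ birkhoffSum (T^[t]) (f t) (2 * k) x / k := by gcongr; exact key k
        _ = _ := by push_cast; field_simp
  simp only [blockAverage]
  rcases Nat.eq_zero_or_pos t with rfl | ht
  · simp
  · have ht' : (0 : ℝ) < t := Nat.cast_pos.2 ht
    push_cast
    rw [div_le_div_iff₀ (by positivity) ht']
    nlinarith

/-- The sequence of integrals of a subadditive cocycle is subadditive. -/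
theorem subadditive_integral (hT : MeasurePreserving T μ μ) (hfi : ∀ n, Integrable (f n) μ)
    (hsub : ∀ m n, ∀ᵐ x ∂μ, f (m + n) x ≤ f m x + f n (T^[m] x)) :
    Subadditive fun n => ∫ x, f n x ∂μ := by
  intro m n
  have hi : Integrable (fun x => f n (T^[m] x)) μ :=
    (hT.iterate m).integrable_comp_of_integrable (hfi n)
  calc _ ≤ ∫ x, (f m x + f n (T^[m] x)) ∂μ :=
        integral_mono_ae (hfi _) ((hfi m).add hi) (hsub m n)
    _ = _ := by
      rw [integral_add (hfi m) hi, (hT.iterate m).integral_comp_self (hfi n).aestronglyMeasurable]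

theorem bddBelow_range_integral_div (hfi : ∀ n, Integrable (f n) μ) {g : α → ℝ}
    (hg : Integrable g μ) (hgf : ∀ n : ℕ, ∀ᵐ x ∂μ, n * g x ≤ f n x) :
    BddBelow (Set.range fun n : ℕ => (∫ x, f n x ∂μ) / n) := by
  -- The `0` covers `n = 0`, where division by zero gives `0`.
  refine ⟨min 0 (∫ x, g x ∂μ), ?_⟩
  rintro _ ⟨n, rfl⟩
  rcases Nat.eq_zero_or_pos n with rfl | hn
  · simp
  · have hn' : (0 : ℝ) < n := Nat.cast_pos.2 hn
    refine min_le_of_right_le ?_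
    rw [le_div_iff₀ hn', mul_comm, ← integral_const_mul]
    exact integral_mono_ae (hg.const_mul _) (hfi n) (hgf n)

/-- Used with `a n = f n x`, `b n = f n (T x)` and `d = f 1 x` to get `L ≤ L ∘ T`. The boundedness
hypotheses rule out default values of the real `liminf`. -/
theorem liminf_le_liminf_of_succ_le {a b : ℕ → ℝ} {c : ℝ}
    (ha : BddBelow (Set.range fun n : ℕ => a n / n))
    (hb' : ∀ᶠ n : ℕ in atTop, b n / n < c)
    {d : ℝ} (hab : ∀ n, a (n + 1) ≤ d + b n) :
    liminf (fun n : ℕ => a n / n) atTop ≤ liminf (fun n : ℕ => b n / n) atTop := by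
  have hcb : IsCoboundedUnder (· ≥ ·) atTop fun n : ℕ => b n / n :=
    (isBoundedUnder_of_eventually_le (hb'.mono fun _ h => h.le)).isCoboundedUnder_ge
  refine le_of_forall_gt fun y hy => ?_
  obtain ⟨z, hz, hzy⟩ := exists_between hy
  have hfr : ∃ᶠ n : ℕ in atTop, b n / n < z := frequently_lt_of_liminf_lt hcb hz
  have hlim : Tendsto (fun n : ℕ => d / ((n + 1 : ℕ) : ℝ) + z * ((n : ℝ) / ((n + 1 : ℕ) : ℝ))) atTop
      (𝓝 (0 + z * 1)) := by
    refine ((tendsto_const_div_atTop_nhds_zero_nat d).comp (tendsto_add_atTop_nat 1)).add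
      (Tendsto.const_mul z ?_)
    simpa using tendsto_natCast_div_add_atTop (𝕜 := ℝ) 1
  obtain ⟨y', hy', hyy⟩ := exists_between hzy
  have hfr2 : ∃ᶠ n : ℕ in atTop, a n / n < y' := by
    have h1 : ∃ᶠ n : ℕ in atTop, a (n + 1) / ((n + 1 : ℕ) : ℝ) < y' := by
      refine (hfr.and_eventually ((hlim.eventually_lt_const (show _ < y' by linarith)).and
        (eventually_gt_atTop 0))).mono ?_
      rintro n ⟨hn1, hn2, hn3⟩
      refine lt_of_le_of_lt ?_ hn2
      have hn' : (0 : ℝ) < n := Nat.cast_pos.2 hn3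
      rw [← mul_div_assoc, ← add_div]
      gcongr
      rw [div_lt_iff₀ hn'] at hn1
      linarith [hab n]
    exact (tendsto_add_atTop_nat 1).frequently h1
  refine lt_of_le_of_lt (liminf_le_of_frequently_le (hfr2.mono fun _ h => h.le) ?_) hyy
  exact ha.isBoundedUnder_of_range

end KingmanUpper

/-! ### Kingman's theorem along doubling blocks. -/

section KingmanMain

variable {α : Type*} [MeasurableSpace α] {μ : Measure α} {T : α → α} {f : ℕ → α → ℝ}

/-- **Kingman's subadditive ergodic theorem**, for a real subadditive cocycle with a common
integrable lower bound for `f n / n`, together with the convergence of the block averages along a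
doubling sequence of block lengths. -/
theorem exists_tendsto_of_subadditive [IsProbabilityMeasure μ] (hT : MeasurePreserving T μ μ)
    (h0 : ∀ x, f 0 x = 0) (hfm : ∀ n, Measurable (f n)) (hfi : ∀ n, Integrable (f n) μ)
    (hsub : ∀ m n, ∀ᵐ x ∂μ, f (m + n) x ≤ f m x + f n (T^[m] x)) {g : α → ℝ}
    (hg : Integrable g μ) (hgf : ∀ n : ℕ, ∀ᵐ x ∂μ, n * g x ≤ f n x)
    {t : ℕ → ℕ} (ht0 : 1 ≤ t 0) (ht : ∀ l, t (l + 1) = 2 * t l) :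
    ∃ L : α → ℝ, Measurable L ∧ Integrable L μ ∧
      Tendsto (fun n : ℕ => (∫ x, f n x ∂μ) / n) atTop (𝓝 (∫ x, L x ∂μ)) ∧
      IsGLB ((fun n : ℕ => (∫ x, f n x ∂μ) / n) '' Set.Ici 1) (∫ x, L x ∂μ) ∧
      (∀ᵐ x ∂μ, L (T x) = L x) ∧
      (∀ᵐ x ∂μ, Tendsto (fun n : ℕ => f n x / n) atTop (𝓝 (L x))) ∧
      ∀ᵐ x ∂μ, Tendsto (fun l => blockAverage μ T f (t l) x) atTop (𝓝 (L x)) := by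
  have hUB : ∀ s, 1 ≤ s → ∀ᵐ x ∂μ, ∀ a, blockAverage μ T f s x < a →
      ∀ᶠ n : ℕ in atTop, f n x / n < a := fun s hs =>
    ae_eventually_div_lt_of_blockAverage_lt hT h0 hfm hfi hsub hs
  have hge : ∀ᵐ x ∂μ, ∀ n : ℕ, 1 ≤ n → g x ≤ f n x / n := by
    filter_upwards [ae_all_iff.2 hgf] with x hx n hn
    rw [le_div_iff₀ (Nat.cast_pos.2 hn), mul_comm]
    exact hx n
  have hbelow : ∀ᵐ x ∂μ, BddBelow (Set.range fun n : ℕ => f n x / n) := by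
    filter_upwards [hge] with x hx
    refine ⟨min 0 (g x), ?_⟩
    rintro _ ⟨n, rfl⟩
    rcases Nat.eq_zero_or_pos n with rfl | hn
    · simp
    · exact min_le_of_right_le (hx n hn)
  have hcob : ∀ᵐ x ∂μ, IsCoboundedUnder (· ≥ ·) atTop fun n : ℕ => f n x / n := by
    filter_upwards [hUB 1 le_rfl] with x hx
    exact (isBoundedUnder_of_eventually_le
      ((hx _ (lt_add_one _)).mono fun _ h => h.le)).isCoboundedUnder_ge
  set L : α → ℝ := fun x => liminf (fun n : ℕ => f n x / n) atTop with hLdef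
  have hLm : Measurable L := Measurable.liminf fun n => (hfm n).div_const _
  have hLle : ∀ s, 1 ≤ s → ∀ᵐ x ∂μ, L x ≤ blockAverage μ T f s x := by
    intro s hs
    filter_upwards [hUB s hs, hbelow] with x hx hb
    refine le_of_forall_gt_imp_ge_of_dense fun a ha => ?_
    exact liminf_le_of_frequently_le ((hx a ha).mono fun _ h => h.le).frequently
      hb.isBoundedUnder_of_range
  have hgL : ∀ᵐ x ∂μ, g x ≤ L x := by
    filter_upwards [hge, hcob] with x hx hc
    exact le_liminf_of_le hc (eventually_atTop.2 ⟨1, hx⟩)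
  have hLi : Integrable L μ := by
    refine (hg.abs.add (integrable_blockAverage (μ := μ) (T := T) (f := f) 1).abs).mono'
      hLm.aestronglyMeasurable ?_
    filter_upwards [hgL, hLle 1 le_rfl] with x h1 h2
    simp only [Pi.add_apply]
    rw [Real.norm_eq_abs, abs_le]
    constructor
    · linarith [neg_abs_le (g x), abs_nonneg (blockAverage μ T f 1 x)]
    · linarith [le_abs_self (blockAverage μ T f 1 x), abs_nonneg (g x)]
  have hLle_comp : ∀ᵐ x ∂μ, L x ≤ L (T x) := by
    filter_upwards [hbelow,
      hT.quasiMeasurePreserving.ae (hUB 1 le_rfl), ae_all_iff.2 (hsub 1)] with x h1 h3 h4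
    exact liminf_le_liminf_of_succ_le (a := fun n => f n x) (b := fun n => f n (T x)) h1
      (h3 _ (lt_add_one _)) fun n => by rw [add_comm n 1]; exact h4 n
  have hLTi : Integrable (fun x => L (T x)) μ := hT.integrable_comp_of_integrable hLi
  -- `L ≤ L ∘ T` and both sides have the same integral.
  have hLT : ∀ᵐ x ∂μ, L (T x) = L x := by
    have hz : ∫ x, (L (T x) - L x) ∂μ = 0 := by
      rw [integral_sub hLTi hLi, hT.integral_comp_self hLi.aestronglyMeasurable, sub_self]
    have := (integral_eq_zero_iff_of_nonneg_ae
      (by filter_upwards [hLle_comp] with x hx using sub_nonneg.2 hx) (hLTi.sub hLi)).1 hz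
    filter_upwards [this] with x hx using sub_eq_zero.1 hx
  have hI := subadditive_integral hT hfi hsub
  have hIb := bddBelow_range_integral_div hfi hg hgf
  have hIlim := hI.tendsto_lim hIb
  have htpos : ∀ l, 1 ≤ t l := by
    intro l
    induction l with
    | zero => exact ht0
    | succ l ih => rw [ht]; omega
  have httop : Tendsto t atTop atTop :=
    (strictMono_nat_of_lt_succ fun l => by rw [ht]; have := htpos l; omega).tendsto_atTop
  have hblock : Tendsto (fun l => ∫ x, blockAverage μ T f (t l) x ∂μ) atTop (𝓝 hI.lim) := by
    simp_rw [integral_blockAverage]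
    exact hIlim.comp httop
  have hLγ : ∫ x, L x ∂μ = hI.lim := by
    refine le_antisymm (ge_of_tendsto' hblock fun l =>
      integral_mono_ae hLi (integrable_blockAverage _) (hLle _ (htpos l))) ?_
    refine le_integral_of_frequently_lt hT h0 hfm hfi hsub hLm hLi hLT ?_ fun n => ?_
    · filter_upwards [hcob] with x hc a ha
      obtain ⟨n, hn, hn1⟩ := ((frequently_lt_of_liminf_lt hc ha).and_eventually
        (eventually_ge_atTop 1)).exists
      refine ⟨n, hn1, ?_⟩
      rw [div_lt_iff₀ (Nat.cast_pos.2 hn1)] at hn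
      linarith
    · rcases Nat.eq_zero_or_pos n with rfl | hn
      · simp [h0]
      · have := hI.lim_le_div hIb hn.ne'
        rw [le_div_iff₀ (Nat.cast_pos.2 hn)] at this
        linarith
  have hconv : ∀ᵐ x ∂μ, Tendsto (fun l => blockAverage μ T f (t l) x) atTop (𝓝 (L x)) := by
    refine tendsto_of_integral_tendsto_of_antitone (fun l => integrable_blockAverage _) hLi
      (by rwa [hLγ]) ?_ (ae_all_iff.2 fun l => hLle _ (htpos l))
    filter_upwards [ae_all_iff.2 fun l => ae_blockAverage_two_mul_le hT hfm hfi hsub (t l)]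
      with x hx
    exact antitone_nat_of_succ_le fun l => by rw [ht]; exact hx l
  refine ⟨L, hLm, hLi, by rwa [hLγ], ?_, hLT, ?_, hconv⟩
  · rw [hLγ, Subadditive.lim]
    exact isGLB_csInf (Set.Nonempty.image _ ⟨1, Set.mem_Ici.2 le_rfl⟩)
      (hIb.mono (Set.image_subset_range _ _))
  · filter_upwards [hconv, ae_all_iff.2 fun l => hUB (t l) (htpos l), hbelow] with x hx hU hb
    refine tendsto_order.2 ⟨fun a ha => ?_, fun a ha => ?_⟩
    · exact eventually_lt_of_lt_liminf ha hb.isBoundedUnder_of_range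
    · obtain ⟨l, hl⟩ := (hx.eventually_lt_const ha).exists
      exact hU l a hl

end KingmanMain

/-! ### Transfer to extended real values. -/

theorem lemma2p4 {X : Type*} [TopologicalSpace X] [CompactSpace X]
    [TopologicalSpace.MetrizableSpace X] [MeasurableSpace X] [BorelSpace X]
    (μ : Measure X) [IsProbabilityMeasure μ]
    (θ : X → X) (hθ : MeasurePreserving θ μ μ)
    (t : ℕ → ℕ) (ht₁ : 1 ≤ t 1) (ht : ∀ l, 1 ≤ l → t (l + 1) = 2 * t l)
    -- `φ n x` takes values in `ℝ ∪ {-∞}`, i.e. in `EReal` without `⊤`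
    (φ : ℕ → X → EReal) (hφ_top : ∀ n, 1 ≤ n → ∀ x, φ n x ≠ ⊤)
    (hφ_meas : ∀ n, 1 ≤ n → Measurable (φ n))
    (hφ_sub : ∀ k₁ k₂, 1 ≤ k₁ → 1 ≤ k₂ →
      ∀ᵐ x ∂μ, φ (k₁ + k₂) x ≤ φ k₁ x + φ k₂ (θ^[k₁] x))
    -- (a) every `φ n` is integrable
    (hφ_int : ∀ n, 1 ≤ n → ∫⁻ x, (φ n x).abs ∂μ < ⊤)
    -- (b) the functions `φ n / n` have a common integrable lower bound
    (hφ_bdd : ∃ g : X → ℝ, Integrable g μ ∧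
      ∀ n : ℕ, 1 ≤ n → ∀ᵐ x ∂μ, (g x : EReal) ≤ φ n x / (n : EReal)) :
    ∃ φbar : X → ℝ, Measurable φbar ∧ Integrable φbar μ ∧
      Tendsto (fun n : ℕ => (∫ x, (φ n x).toReal ∂μ) / (n : ℝ)) atTop (𝓝 (∫ x, φbar x ∂μ)) ∧
      IsGLB ((fun n : ℕ => (∫ x, (φ n x).toReal ∂μ) / (n : ℝ)) '' Set.Ici 1)
        (∫ x, φbar x ∂μ) ∧
      ∃ Γ : Set X, MeasurableSet Γ ∧ μ Γ = 1 ∧ ∀ x ∈ Γ,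
        Tendsto (fun n : ℕ => φ n x / (n : EReal)) atTop (𝓝 (φbar x : EReal)) ∧
        (∀ n : ℕ, 0 < n → φbar (θ^[n] x) = φbar x) ∧
        ∃ h : ℕ → ℝ,
          (∀ l, 1 ≤ l →
            Tendsto
              (fun k : ℕ =>
                (∑ j ∈ Finset.range k, φ (t l) (θ^[j * t l] x) / (t l : EReal)) / (k : EReal))
              atTop (𝓝 (h l : EReal))) ∧
          Tendsto h atTop (𝓝 (φbar x)) := by
  classical
  obtain ⟨g, hg, hgφ⟩ := hφ_bdd
  -- `φ 0` is unconstrained, while the real cocycle needs `f 0 = 0`.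
  set f : ℕ → X → ℝ := fun n x => if n = 0 then 0 else (φ n x).toReal with hf
  have hfφ : ∀ n, 1 ≤ n → f n = fun x => (φ n x).toReal := fun n hn => by
    funext x
    simp [hf, Nat.one_le_iff_ne_zero.1 hn]
  have h0 : ∀ x, f 0 x = 0 := fun x => by simp [hf]
  have hfm : ∀ n, Measurable (f n) := by
    intro n
    rcases Nat.eq_zero_or_pos n with rfl | hn
    · simp [hf]
    · rw [hfφ n hn]
      exact (hφ_meas n hn).ereal_toReal
  have hbot : ∀ n, 1 ≤ n → ∀ᵐ x ∂μ, φ n x ≠ ⊥ := by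
    intro n hn
    filter_upwards [hgφ n hn] with x hx hb
    rw [hb, EReal.bot_div_of_pos_ne_top (by exact_mod_cast hn) (EReal.natCast_ne_top n)] at hx
    exact EReal.coe_ne_bot _ (le_bot_iff.1 hx)
  have hcoe : ∀ᵐ x ∂μ, ∀ i n : ℕ, 1 ≤ n → φ n (θ^[i] x) = (f n (θ^[i] x) : EReal) := by
    refine hθ.ae_forall_iterate (p := fun x => ∀ n : ℕ, 1 ≤ n → φ n x = (f n x : EReal)) ?_
    refine ae_all_iff.2 fun n => ?_
    by_cases hn : 1 ≤ n
    · filter_upwards [hbot n hn] with x hx _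
      rw [hfφ n hn, EReal.coe_toReal (hφ_top n hn x) hx]
    · exact ae_of_all _ fun x h => absurd h hn
  have hfi : ∀ n, Integrable (f n) μ := by
    intro n
    rcases Nat.eq_zero_or_pos n with rfl | hn
    · simp [hf]
    · refine ⟨(hfm n).aestronglyMeasurable, ?_⟩
      refine lt_of_le_of_lt (lintegral_mono_ae ?_) (hφ_int n hn)
      filter_upwards [hcoe] with x hx
      have := hx 0 n hn
      simp only [Function.iterate_zero, id_eq] at this
      rw [this, EReal.abs_def, Real.enorm_eq_ofReal_abs]
  have hsub : ∀ m n, ∀ᵐ x ∂μ, f (m + n) x ≤ f m x + f n (θ^[m] x) := by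
    intro m n
    rcases Nat.eq_zero_or_pos m with rfl | hm
    · simp [h0]
    rcases Nat.eq_zero_or_pos n with rfl | hn
    · simp [h0]
    filter_upwards [hφ_sub m n hm hn, hcoe] with x hx hc
    have h1 := hc 0 (m + n) (by omega)
    have h2 := hc 0 m hm
    simp only [Function.iterate_zero, id_eq] at h1 h2
    rw [h1, h2, hc m n hn] at hx
    exact_mod_cast hx
  have hgf : ∀ n : ℕ, ∀ᵐ x ∂μ, n * g x ≤ f n x := by
    intro n
    rcases Nat.eq_zero_or_pos n with rfl | hn
    · simp [h0]
    filter_upwards [hgφ n hn, hcoe] with x hx hc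
    have h1 := hc 0 n hn
    simp only [Function.iterate_zero, id_eq] at h1
    rw [h1, ← EReal.coe_coe_eq_natCast, ← EReal.coe_div, EReal.coe_le_coe_iff,
      le_div_iff₀ (Nat.cast_pos.2 hn)] at hx
    linarith
  -- The shift `l + 1` is needed because nothing is known about `t 0`.
  obtain ⟨L, hLm, hLi, hlim, hglb, hinv, hpt, hblk⟩ := exists_tendsto_of_subadditive hθ h0 hfm hfi
    hsub hg hgf (t := fun l => t (l + 1)) ht₁ fun l => ht (l + 1) (by omega)
  have hint : ∀ n : ℕ, 1 ≤ n → (∫ x, f n x ∂μ) / n = (∫ x, (φ n x).toReal ∂μ) / (n : ℝ) :=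
    fun n hn => by rw [hfφ n hn]
  have htpos : ∀ l, 1 ≤ l → 1 ≤ t l := by
    intro l hl
    induction l, hl using Nat.le_induction with
    | base => exact ht₁
    | succ l hl ih => rw [ht l hl]; omega
  have hall : ∀ᵐ x ∂μ,
      Tendsto (fun n : ℕ => φ n x / (n : EReal)) atTop (𝓝 (L x : EReal)) ∧
      (∀ n : ℕ, 0 < n → L (θ^[n] x) = L x) ∧
      ∃ h : ℕ → ℝ,
        (∀ l, 1 ≤ l →
          Tendsto
            (fun k : ℕ =>
              (∑ j ∈ Finset.range k, φ (t l) (θ^[j * t l] x) / (t l : EReal)) / (k : EReal))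
            atTop (𝓝 (h l : EReal))) ∧
        Tendsto h atTop (𝓝 (L x)) := by
    filter_upwards [hpt, hθ.ae_forall_iterate hinv, hblk, hcoe, ae_all_iff.2 fun l =>
      ae_tendsto_birkhoffSum_div (hθ.iterate (t l)) (hfm (t l)) (hfi (t l))] with x h1 h2 h3 h4 h5
    refine ⟨?_, fun n _ => ?_, fun l => blockAverage μ θ f (t l) x, fun l hl => ?_,
      (tendsto_add_atTop_iff_nat 1).1 h3⟩
    · refine (EReal.tendsto_coe.2 h1).congr' ?_
      filter_upwards [eventually_ge_atTop 1] with n hn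
      have := h4 0 n hn
      simp only [Function.iterate_zero, id_eq] at this
      rw [this, EReal.coe_div, EReal.coe_coe_eq_natCast]
    · induction n with
      | zero => rfl
      | succ n ih =>
        rw [Function.iterate_succ_apply', h2 n]
        rcases Nat.eq_zero_or_pos n with rfl | hn
        · rfl
        · exact ih hn
    · refine (EReal.tendsto_coe.2 ((h5 l).div_const (t l : ℝ))).congr fun k => ?_
      have hterm : ∀ j, φ (t l) (θ^[j * t l] x) / (t l : EReal) =
          ((f (t l) ((θ^[t l])^[j] x) / (t l : ℝ) : ℝ) : EReal) := by
        intro j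
        rw [h4 _ _ (htpos l hl), ← Function.iterate_mul, mul_comm j, EReal.coe_div,
          EReal.coe_coe_eq_natCast]
      simp_rw [hterm]
      have hsum : ∀ a : ℕ → ℝ, ∑ j ∈ Finset.range k, (a j : EReal) =
          ((∑ j ∈ Finset.range k, a j : ℝ) : EReal) := fun a =>
        (map_sum (⟨⟨Real.toEReal, EReal.coe_zero⟩, EReal.coe_add⟩ : ℝ →+ EReal) a _).symm
      rw [← EReal.coe_coe_eq_natCast k, hsum, ← EReal.coe_div, ← Finset.sum_div]
      rw [birkhoffSum, div_right_comm]
  obtain ⟨s, hs, hsm, hs0⟩ := exists_measurable_superset_of_null (ae_iff.1 hall)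
  refine ⟨L, hLm, hLi, hlim.congr' ?_, ?_, sᶜ, hsm.compl, ?_, fun x hx => ?_⟩
  · filter_upwards [eventually_ge_atTop 1] with n hn using hint n hn
  · rwa [Set.image_congr (s := Set.Ici 1) fun n hn => hint n hn] at hglb
  · rw [prob_compl_eq_one_iff hsm, hs0]
  · by_contra hcon
    exact hx (hs hcon)
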